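/- For $0<u\le 1$ let $\zeta(s,u)$ be the Hurwitz zeta function, i.e. the meromorphic continuation to $\mathbb{C}$ of $\sum_{n\ge 0}(n+u)^{-s}$ ($\operatorname{Re} s>1$), let primes denote derivatives with respect to $s$, and let the generalised Stieltjes constants $\gamma_n(u)$ be defined by the Laurent expansion $$\zeta(s,u)=\frac{1}{s-1}+\sum_{n=0}^{\infty}\frac{(-1)^n}{n!}\gamma_n(u)(s-1)^n .$$ Let $\gamma$ be Euler's constant. Let $p,q$ be positive integers with $p<q$, and put $$R=2\pi\sum_{j=1}^{q}\sin\left(\frac{2\pi jp}{q}\right)\zeta''\left(0,\frac jq\right)-4\pi\,[\gamma+\log(2\pi q)]\sum_{j=1}^{q}\sin\left(\frac{2\pi jp}{q}\right)\log\Gamma\left(\frac jq\right)+\frac{\pi}{2}\left(2[\gamma+\log(2\pi q)]^2+\frac{\pi^2}{6}\right)\cot\left(\frac{\pi p}{q}\right).$$ Then $$\lim_{s\to 1}\left[\zeta''\left(s,\frac pq\right)-\zeta''\left(s,1-\frac pq\right)\right]=R \qquad\text{and}\qquad \gamma_2\left(\frac pq\right)-\gamma_2\left(1-\frac pq\right)=R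 .$$ -/

import Mathlib

open Filter Topology

noncomputable section

/-- The Hurwitz zeta function `ζ(·, u)` with its principal part `1 / (s - 1)` removed, extended to
`s = 1` by its limit there. (`HurwitzZeta.hurwitzZeta` is periodic in the parameter, and is the
classical `ζ(s, u)` for `0 < u ≤ 1`.) -/
def hurwitzRegularPart (u : ℝ) : ℂ → ℂ :=
  Function.update (fun s : ℂ => HurwitzZeta.hurwitzZeta (u : UnitAddCircle) s - 1 / (s - 1)) 1
    (limUnder (𝓝[≠] (1 : ℂ))
      (fun s : ℂ => HurwitzZeta.hurwitzZeta (u : UnitAddCircle) s - 1 / (s - 1)))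

/-- The generalised Stieltjes constant `γ_n(u)`, for `0 < u ≤ 1`: the coefficient in the Laurent
expansion `ζ(s, u) = 1 / (s - 1) + ∑ n, (-1) ^ n / n! * γ_n(u) * (s - 1) ^ n` about `s = 1`. -/
def stieltjesConst (n : ℕ) (u : ℝ) : ℂ :=
  (-1) ^ n * iteratedDeriv n (hurwitzRegularPart u) 1

theorem differentiable_hurwitzRegularPart (u : ℝ) : Differentiable ℂ (hurwitzRegularPart u) := by
  rw [← differentiableOn_univ]
  refine Complex.differentiableOn_update_limUnder_of_isLittleO Filter.univ_mem ?_ ?_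
  · intro s hs
    have hs1 : s ≠ 1 := hs.2
    refine ((HurwitzZeta.differentiableAt_hurwitzZeta _ hs1).sub ?_).differentiableWithinAt
    exact (differentiableAt_const _).div (by fun_prop) (sub_ne_zero.mpr hs1)
  · have hne : ∀ᶠ s : ℂ in 𝓝[≠] 1, s ≠ 1 := self_mem_nhdsWithin
    rw [Asymptotics.isLittleO_iff_tendsto']
    · set c := HurwitzZeta.hurwitzZeta (u : UnitAddCircle) 1 - 1 / ((1 : ℂ) - 1)
      have h1 := HurwitzZeta.hurwitzZeta_residue_one (u : UnitAddCircle)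
      have h2 : Tendsto (fun s : ℂ => 1 + (s - 1) * c) (𝓝[≠] 1) (𝓝 (1 + (1 - 1) * c)) :=
        ((by fun_prop : Continuous fun s : ℂ => 1 + (s - 1) * c).tendsto 1).mono_left
          nhdsWithin_le_nhds
      have h3 := h1.sub h2
      simp only [sub_self, zero_mul, add_zero] at h3
      refine h3.congr' ?_
      filter_upwards [hne] with s hs
      have : s - 1 ≠ 0 := sub_ne_zero.mpr hs
      field_simp
      ring
    · filter_upwards [hne] with s hs h
      exact absurd (inv_eq_zero.mp h) (sub_ne_zero.mpr hs)

/-- The Laurent expansion of the Hurwitz zeta function about `s = 1`. -/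
theorem hasSum_stieltjesConst (u : ℝ) {s : ℂ} (hs : s ≠ 1) :
    HasSum (fun n : ℕ => (-1 : ℂ) ^ n / (n.factorial : ℂ) * stieltjesConst n u * (s - 1) ^ n)
      (HurwitzZeta.hurwitzZeta (u : UnitAddCircle) s - 1 / (s - 1)) := by
  have h := Complex.hasSum_taylorSeries_of_entire (differentiable_hurwitzRegularPart u) 1 s
  have e : hurwitzRegularPart u s =
      HurwitzZeta.hurwitzZeta (u : UnitAddCircle) s - 1 / (s - 1) := by
    simp [hurwitzRegularPart, hs]
  rw [e] at h
  refine h.congr_fun ?_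
  intro n
  have : ((-1 : ℂ) ^ n) * (-1) ^ n = 1 := by rw [← mul_pow]; simp
  simp only [stieltjesConst, smul_eq_mul]
  linear_combination
    (iteratedDeriv n (hurwitzRegularPart u) 1 * (s - 1) ^ n / (n.factorial : ℂ)) * this

end

/-! Modulo 1, `1 - p/q` is `-p/q`, so the difference in question is twice the odd part of the
Hurwitz zeta function. It is entire, the poles cancelling, and both claims compute its second
derivative at 1. The functional equation of the odd part turns `ζ(1 - s, p/q) - ζ(1 - s, -p/q)` into
`4 (2π)^(-s) Γ(s) sin(πs/2)` times the sine zeta function at `p/q`, which for rational argument is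
`q^(-s) ∑ sin(2πjp/q) ζ(s, j/q)`. Hence near 0 the difference is `oddFactor * sinHurwitzSum`
(`hurwitzZeta_sub_neg_one_sub_eventuallyEq`), and Leibniz' rule at 0 gives three terms. The factor
contributes `γ + log(2πq)` and `π²`, the latter through `Γ''(1)` and the sine. The sum contributes
`ζ''(0, j/q)` untouched, Lerch's `ζ'(0, u) = log Γ(u) + ζ'(0)`, and `ζ(0, u) = 1/2 - u`. Since `∑
sin(2πjp/q) = 0`, the constants `ζ'(0)` and `1/2` drop out, and `∑ (j/q) sin(2πjp/q)` produces the
cotangent. -/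

/-! ### Second-order Taylor data of `sin (c s) / s` and `Γ(1 + s)` at 0 -/

theorem iteratedDeriv_two_fun_mul {f g : ℂ → ℂ} {x : ℂ} (hf : AnalyticAt ℂ f x)
    (hg : AnalyticAt ℂ g x) :
    iteratedDeriv 2 (fun s => f s * g s) x =
      iteratedDeriv 2 f x * g x + 2 * (deriv f x * deriv g x) + f x * iteratedDeriv 2 g x := by
  rw [iteratedDeriv_fun_mul hf.contDiffAt hg.contDiffAt]
  simp [Finset.sum_range_succ, iteratedDeriv_zero, iteratedDeriv_one]
  ring

/-- The entire function `s ↦ sin (c * s) / s`. -/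
noncomputable def sinDiv (c : ℂ) : ℂ → ℂ := dslope (fun s : ℂ => Complex.sin (c * s)) 0

theorem differentiable_sinDiv (c : ℂ) :
    Differentiable ℂ (sinDiv c) := by
  rw [sinDiv, ← differentiableOn_univ, Complex.differentiableOn_dslope univ_mem]
  fun_prop

theorem mul_sinDiv (c s : ℂ) :
    s * sinDiv c s = Complex.sin (c * s) := by
  simpa [sinDiv] using sub_smul_dslope (fun s : ℂ => Complex.sin (c * s)) 0 s

theorem sinDiv_zero (c : ℂ) : sinDiv c 0 = c := by
  have : HasDerivAt (fun s : ℂ => Complex.sin (c * s)) (Complex.cos (c * 0) * (c * 1)) 0 :=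
    ((hasDerivAt_id (0 : ℂ)).const_mul c).csin
  rw [sinDiv, dslope_same, this.deriv]
  simp

theorem iteratedDeriv_id_mul_zero (n : ℕ) {f : ℂ → ℂ} (hf : AnalyticAt ℂ f 0) :
    iteratedDeriv (n + 1) (fun s => s * f s) 0 = (n + 1) * iteratedDeriv n f 0 := by
  have h := iteratedDeriv_fun_mul (n := n + 1) (f := fun s : ℂ => s) (g := f) (x := 0)
    contDiffAt_id hf.contDiffAt
  rw [h, Finset.sum_eq_single 1]
  · simp [iteratedDeriv_one]
  · intro i _ hi
    rcases i with _ | _ | i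
    · simp
    · simp at hi
    · have : iteratedDeriv (i + 1 + 1) (fun s : ℂ => s) 0 = 0 := by
        rw [iteratedDeriv_succ', iteratedDeriv_succ']
        simp
      simp [this]
  · simp

theorem deriv_sin_const_mul (c : ℂ) :
    deriv (fun s : ℂ => Complex.sin (c * s)) = fun s => c * Complex.cos (c * s) := by
  ext s
  have : HasDerivAt (fun s : ℂ => Complex.sin (c * s)) (Complex.cos (c * s) * (c * 1)) s :=
    ((hasDerivAt_id s).const_mul c).csin
  rw [this.deriv]
  ring

theorem deriv_cos_const_mul (c : ℂ) :
    deriv (fun s : ℂ => c * Complex.cos (c * s)) = fun s => -c ^ 2 * Complex.sin (c * s) := by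
  ext s
  have : HasDerivAt (fun s : ℂ => c * Complex.cos (c * s))
      (c * (-Complex.sin (c * s) * (c * 1))) s :=
    ((hasDerivAt_id s).const_mul c).ccos.const_mul c
  rw [this.deriv]
  ring

theorem deriv_sinDiv_zero (c : ℂ) :
    deriv (sinDiv c) 0 = 0 := by
  have h := iteratedDeriv_id_mul_zero 1 ((differentiable_sinDiv c).analyticAt 0)
  simp only [mul_sinDiv] at h
  rw [iteratedDeriv_succ', iteratedDeriv_one, iteratedDeriv_one, deriv_sin_const_mul,
    deriv_cos_const_mul] at h
  simpa using h

theorem iteratedDeriv_two_sinDiv_zero (c : ℂ) :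
    iteratedDeriv 2 (sinDiv c) 0 = -c ^ 3 / 3 := by
  have h := iteratedDeriv_id_mul_zero 2 ((differentiable_sinDiv c).analyticAt 0)
  simp only [mul_sinDiv] at h
  rw [iteratedDeriv_succ', iteratedDeriv_succ', iteratedDeriv_one, deriv_sin_const_mul,
    deriv_cos_const_mul, deriv_const_mul_field, deriv_sin_const_mul] at h
  simp at h
  rw [eq_div_iff (by norm_num)]
  linear_combination -h

theorem analyticAt_Gamma_one_add : AnalyticAt ℂ (fun s : ℂ => Complex.Gamma (1 + s)) 0 := by
  rw [Complex.analyticAt_iff_eventually_differentiableAt]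
  have : ∀ᶠ s : ℂ in 𝓝 0, -1 < s.re :=
    (isOpen_lt continuous_const Complex.continuous_re).mem_nhds (by simp)
  filter_upwards [this] with s hs
  refine DifferentiableAt.comp (f := fun s : ℂ => 1 + s) s
    (Complex.differentiableAt_Gamma _ fun m hm => ?_) (by fun_prop)
  have := congrArg Complex.re hm
  simp at this
  have : (0 : ℝ) ≤ m := by positivity
  linarith

theorem deriv_Gamma_one_add_zero :
    deriv (fun s : ℂ => Complex.Gamma (1 + s)) 0 = -Real.eulerMascheroniConstant := by
  rw [deriv_comp_const_add]
  simpa using Complex.hasDerivAt_Gamma_one.deriv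

/-- Differentiating the reflection formula `Γ(1 + s) Γ(1 - s) · sin(πs)/s = π` twice at 0 gives `π
(2 Γ''(1) - 2 γ²) - π³/3 = 0`. -/
theorem iteratedDeriv_two_Gamma_one_add_zero :
    iteratedDeriv 2 (fun s : ℂ => Complex.Gamma (1 + s)) 0 =
      Real.eulerMascheroniConstant ^ 2 + Real.pi ^ 2 / 6 := by
  set g : ℂ → ℂ := fun s => Complex.Gamma (1 + s)
  have hg : AnalyticAt ℂ g 0 := analyticAt_Gamma_one_add
  have hgn : AnalyticAt ℂ (fun s => g (-s)) 0 :=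
    AnalyticAt.fun_comp (by simpa using hg) analyticAt_id.neg
  let S := sinDiv Real.pi
  have hS : AnalyticAt ℂ S 0 := (differentiable_sinDiv _).analyticAt 0
  have hrefl : (fun s => g s * g (-s) * S s) =ᶠ[𝓝 0] fun _ => (Real.pi : ℂ) := by
    -- In the open unit disc, `sin(πs)` vanishes only at 0.
    have h1 : ∀ᶠ s : ℂ in 𝓝 0, ‖s‖ < 1 := by
      filter_upwards [Metric.ball_mem_nhds (0 : ℂ) one_pos] with s hs using by simpa using hs
    filter_upwards [h1] with s hs
    rcases eq_or_ne s 0 with rfl | hs0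
    · simp [g, S, sinDiv_zero]
    · have hsin : Complex.sin (Real.pi * s) ≠ 0 := by
        intro h
        obtain ⟨k, hk⟩ := Complex.sin_eq_zero_iff.mp h
        have hpi : (Real.pi : ℂ) ≠ 0 := by exact_mod_cast Real.pi_ne_zero
        have hsk : s = k := mul_left_cancel₀ hpi (by rw [hk]; ring)
        rw [hsk, Complex.norm_intCast] at hs
        have : k = 0 := by
          rw [← Int.abs_lt_one_iff]
          exact_mod_cast hs
        exact hs0 (by simp [hsk, this])
      have h2 := Complex.Gamma_mul_Gamma_one_sub s
      have h3 : g s = s * Complex.Gamma s := by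
        simp only [g]
        rw [add_comm, Complex.Gamma_add_one s hs0]
      have h4 : g (-s) = Complex.Gamma (1 - s) := by simp [g, sub_eq_add_neg]
      rw [eq_div_iff hsin, ← mul_sinDiv] at h2
      rw [h3, h4]
      linear_combination h2
  have hd1 : deriv (fun s => g (-s)) 0 = -deriv g 0 := by
    rw [deriv_comp_neg]; simp
  have hd2 : iteratedDeriv 2 (fun s => g (-s)) 0 = iteratedDeriv 2 g 0 := by
    rw [iteratedDeriv_comp_neg]; simp
  have hg0 : g 0 = 1 := by simp [g]
  have h := hrefl.iteratedDeriv_eq 2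
  rw [iteratedDeriv_two_fun_mul (f := fun s => g s * g (-s)) (hg.mul hgn) hS, show S = sinDiv Real.pi from rfl,
    iteratedDeriv_two_fun_mul hg hgn, iteratedDeriv_const, deriv_sinDiv_zero, sinDiv_zero,
    iteratedDeriv_two_sinDiv_zero, hd1, hd2,
    show deriv g 0 = -Real.eulerMascheroniConstant from deriv_Gamma_one_add_zero] at h
  simp only [neg_zero, hg0] at h
  have hpi : (Real.pi : ℂ) ≠ 0 := by exact_mod_cast Real.pi_ne_zero
  apply mul_left_cancel₀ hpi
  simp at h
  linear_combination h / 2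

/-! ### Second-order Taylor data of the functional equation's factor -/

theorem iteratedDeriv_exp_neg_mul_zero (c : ℂ) (n : ℕ) :
    iteratedDeriv n (fun s : ℂ => Complex.exp (-c * s)) 0 = (-c) ^ n := by
  rw [iteratedDeriv_cexp_const_mul]; simp

/-- The factor of the functional equation, with argument `1 - s`, relating the two odd zeta
functions of denominator `q`; here `l = log (2 * π * q)`. -/
noncomputable def oddFactor (l : ℂ) (s : ℂ) : ℂ :=
  4 * (Complex.exp (-l * s) * (Complex.Gamma (1 + s) *
    sinDiv (Real.pi / 2) s))

theorem analyticAt_oddFactor (l : ℂ) : AnalyticAt ℂ (oddFactor l) 0 := by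
  refine analyticAt_const.mul (AnalyticAt.mul ?_ (analyticAt_Gamma_one_add.mul
    ((differentiable_sinDiv _).analyticAt 0)))
  exact Differentiable.analyticAt (by fun_prop) 0

theorem oddFactor_zero (l : ℂ) : oddFactor l 0 = 2 * Real.pi := by
  simp [oddFactor, sinDiv_zero]
  ring

theorem deriv_oddFactor_zero (l : ℂ) :
    deriv (oddFactor l) 0 = -2 * Real.pi * (Real.eulerMascheroniConstant + l) := by
  have hE : DifferentiableAt ℂ (fun s : ℂ => Complex.exp (-l * s)) 0 := by fun_prop
  have hG := analyticAt_Gamma_one_add.differentiableAt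
  have hS := (differentiable_sinDiv (Real.pi / 2)) 0
  have hE1 := iteratedDeriv_exp_neg_mul_zero l 1
  rw [iteratedDeriv_one] at hE1
  unfold oddFactor
  rw [deriv_const_mul_field, deriv_fun_mul hE (hG.fun_mul hS), deriv_fun_mul hG hS, hE1,
    deriv_Gamma_one_add_zero, deriv_sinDiv_zero, sinDiv_zero]
  simp
  ring

theorem iteratedDeriv_two_oddFactor_zero (l : ℂ) :
    iteratedDeriv 2 (oddFactor l) 0 =
      2 * Real.pi * ((Real.eulerMascheroniConstant + l) ^ 2 + Real.pi ^ 2 / 12) := by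
  have hE : AnalyticAt ℂ (fun s : ℂ => Complex.exp (-l * s)) 0 :=
    Differentiable.analyticAt (by fun_prop) 0
  have hG := analyticAt_Gamma_one_add
  have hS := (differentiable_sinDiv (Real.pi / 2)).analyticAt 0
  have hE1 := iteratedDeriv_exp_neg_mul_zero l 1
  rw [iteratedDeriv_one] at hE1
  unfold oddFactor
  rw [iteratedDeriv_const_mul_field, iteratedDeriv_two_fun_mul hE (hG.fun_mul hS),
    iteratedDeriv_two_fun_mul hG hS, deriv_fun_mul hG.differentiableAt hS.differentiableAt, hE1,
    iteratedDeriv_exp_neg_mul_zero, deriv_Gamma_one_add_zero, deriv_sinDiv_zero,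
    sinDiv_zero, iteratedDeriv_two_sinDiv_zero, iteratedDeriv_two_Gamma_one_add_zero]
  simp
  ring

/-! ### Lerch's formulas for the Hurwitz zeta function and its derivative at 0 -/

theorem hasDerivAt_ofReal_cpow {y : ℝ} (hy : 0 < y) (r : ℂ) :
    HasDerivAt (fun t : ℝ => (t : ℂ) ^ r) (r * (y : ℂ) ^ (r - 1)) y := by
  rcases eq_or_ne r 0 with rfl | hr
  · simpa using hasDerivAt_const y (1 : ℂ)
  · exact hasDerivAt_ofReal_cpow_const hy.ne' hr

theorem norm_ofReal_cpow_le {m y : ℝ} (hm : 0 < m) (hy : m ≤ y) {r : ℂ} (hr : r.re ≤ 0) :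
    ‖(y : ℂ) ^ r‖ ≤ m ^ r.re := by
  rw [Complex.norm_cpow_eq_rpow_re_of_pos (hm.trans_le hy)]
  exact Real.rpow_le_rpow_of_nonpos hm hy hr

theorem norm_ofReal_cpow_sub_le {m y z : ℝ} (hm : 0 < m) (hy : m ≤ y) (hz : m ≤ z) {r : ℂ}
    (hr : r.re ≤ 1) :
    ‖(z : ℂ) ^ r - (y : ℂ) ^ r‖ ≤ ‖r‖ * m ^ (r.re - 1) * |z - y| := by
  refine Convex.norm_image_sub_le_of_norm_hasDerivWithin_le (s := Set.Ici m)
    (f' := fun t : ℝ => r * (t : ℂ) ^ (r - 1))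
    (fun t ht => (hasDerivAt_ofReal_cpow (hm.trans_le ht) r).hasDerivWithinAt) (fun t ht => ?_)
    (convex_Ici m) hy hz
  rw [norm_mul]
  gcongr
  simpa using norm_ofReal_cpow_le hm ht (r := r - 1) (by simpa using hr)

/-- First-order Taylor remainder: the mean value inequality, with the derivative of the remainder
bounded by `norm_ofReal_cpow_sub_le`. -/
theorem norm_ofReal_cpow_sub_sub_le {m k : ℝ} (hm : 0 < m) (hk : m ≤ k) {r : ℂ} (hr : r.re ≤ 2) :
    ‖(m : ℂ) ^ r - (k : ℂ) ^ r - r * (k : ℂ) ^ (r - 1) * (m - k)‖ ≤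
      ‖r‖ * ‖r - 1‖ * m ^ (r.re - 2) * (k - m) ^ 2 := by
  have h := Convex.norm_image_sub_le_of_norm_hasDerivWithin_le (s := Set.Icc m k)
    (f := fun t : ℝ => (t : ℂ) ^ r - r * (k : ℂ) ^ (r - 1) * t)
    (f' := fun t : ℝ => r * (t : ℂ) ^ (r - 1) - r * (k : ℂ) ^ (r - 1) * 1) (x := k) (y := m)
    (C := ‖r‖ * (‖r - 1‖ * m ^ (r.re - 2) * (k - m)))
    (fun t ht => ((hasDerivAt_ofReal_cpow (hm.trans_le ht.1) r).sub
      ((hasDerivAt_id t).ofReal_comp.const_mul _)).hasDerivWithinAt) (fun t ht => ?_)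
    (convex_Icc m k) (Set.right_mem_Icc.mpr hk) (Set.left_mem_Icc.mpr hk)
  · calc _ = _ := by congr 1; ring
      _ ≤ _ := h
      _ = _ := by
        rw [Real.norm_eq_abs, abs_sub_comm, abs_of_nonneg (sub_nonneg.mpr hk)]
        ring
  · rw [mul_one, ← mul_sub, norm_mul]
    gcongr
    refine (norm_ofReal_cpow_sub_le hm hk ht.1 (r := r - 1) ?_).trans ?_
    · simp; linarith
    · have : |t - k| ≤ k - m := by
        rw [abs_sub_comm, abs_of_nonneg (sub_nonneg.mpr ht.2)]
        linarith [ht.1]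
      have e : (r - 1).re - 1 = r.re - 2 := by simp; ring
      rw [e]
      gcongr

/-- The terms of the series for `ζ(s, u) - ζ(s) + (u - 1) * s * ζ(s + 1)`. -/
noncomputable def lerchTerm (u : ℝ) (n : ℕ) (s : ℂ) : ℂ :=
  1 / ((n : ℂ) + u) ^ s - 1 / ((n : ℂ) + 1) ^ s + (u - 1) * (s * (1 / ((n : ℂ) + 1) ^ (s + 1)))

/-- This exhibits the term as the first-order Taylor remainder of `x ^ (-s)` about `n + 1`,
evaluated at `n + u`. It gains two powers of `n`, so the series converges past `s = 0`. -/
theorem lerchTerm_eq (u : ℝ) (n : ℕ) (s : ℂ) :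
    lerchTerm u n s = ((n + u : ℝ) : ℂ) ^ (-s) - ((n + 1 : ℝ) : ℂ) ^ (-s)
      - -s * ((n + 1 : ℝ) : ℂ) ^ (-s - 1) * ((n + u : ℝ) - (n + 1 : ℝ)) := by
  rw [← neg_add', Complex.cpow_neg, Complex.cpow_neg, Complex.cpow_neg]
  simp only [lerchTerm]
  push_cast
  ring

/-- A bounded convex region on which the series of `lerchTerm` converges uniformly; it contains `0`
and meets the half-plane `1 < re s`. -/
def lerchDomain : Set ℂ := {s | -(1 / 2) < s.re} ∩ Metric.ball 0 3

theorem isOpen_lerchDomain : IsOpen lerchDomain :=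
  (isOpen_lt continuous_const Complex.continuous_re).inter Metric.isOpen_ball

theorem convex_lerchDomain : Convex ℝ lerchDomain :=
  (convex_halfSpace_re_gt _).inter (convex_ball _ _)

theorem norm_lerchTerm_le {u : ℝ} (hu : 0 < u) (hu1 : u ≤ 1) (n : ℕ) {s : ℂ}
    (hs : s ∈ lerchDomain) :
    ‖lerchTerm u n s‖ ≤ 12 * u ^ (-5 : ℝ) * ((n + 1 : ℕ) : ℝ) ^ (-(3 / 2) : ℝ) := by
  obtain ⟨hre, hn⟩ := hs
  replace hre : -(1 / 2) < s.re := hre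
  replace hn : ‖s‖ < 3 := by simpa using hn
  have hre3 : s.re < 3 := (Complex.re_le_norm s).trans_lt hn
  have hk : (1 : ℝ) ≤ n + 1 := by simp
  rw [lerchTerm_eq]
  refine (norm_ofReal_cpow_sub_sub_le (by positivity) (by linarith) ?_).trans ?_
  · simp; linarith
  · have h1 : ‖-s - 1‖ ≤ 4 := by
      refine (norm_sub_le _ _).trans ?_
      rw [norm_neg, norm_one]; linarith
    have h2 : ((n : ℝ) + 1 - (n + u)) ^ 2 ≤ 1 := by nlinarith
    -- On `lerchDomain` the exponent lies between `-5` and `-3/2`. The first bound serves the base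
    -- `u ≤ 1`, the second the base `n + 1 ≥ 1`.
    have h3 : ((n : ℝ) + u) ^ ((-s).re - 2) ≤ u ^ (-5 : ℝ) * ((n + 1 : ℕ) : ℝ) ^ (-(3 / 2) : ℝ) := by
      have h4 : u * (n + 1) ≤ n + u := by nlinarith [mul_nonneg (sub_nonneg.mpr hu1) (Nat.cast_nonneg (α := ℝ) n)]
      refine (Real.rpow_le_rpow_of_nonpos (by positivity) h4 (by simp; linarith)).trans ?_
      rw [Real.mul_rpow hu.le (by positivity)]
      push_cast
      gcongr ?_ * ?_
      · exact Real.rpow_le_rpow_of_exponent_ge hu hu1 (by simp; linarith)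
      · exact Real.rpow_le_rpow_of_exponent_le hk (by simp; linarith)
    rw [norm_neg]
    calc ‖s‖ * ‖-s - 1‖ * ((n : ℝ) + u) ^ ((-s).re - 2) * ((n : ℝ) + 1 - (n + u)) ^ 2
        ≤ 3 * 4 * (u ^ (-5 : ℝ) * ((n + 1 : ℕ) : ℝ) ^ (-(3 / 2) : ℝ)) * 1 := by gcongr
      _ = _ := by ring

theorem summable_lerchBound (u : ℝ) :
    Summable fun n : ℕ => 12 * u ^ (-5 : ℝ) * ((n + 1 : ℕ) : ℝ) ^ (-(3 / 2) : ℝ) :=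
  ((summable_nat_add_iff 1).mpr (Real.summable_nat_rpow.mpr (by norm_num))).mul_left _

theorem hasDerivAt_lerchTerm {u : ℝ} (hu : 0 < u) (n : ℕ) (s : ℂ) :
    HasDerivAt (lerchTerm u n)
      (-(Complex.log ((n : ℂ) + u) * (1 / ((n : ℂ) + u) ^ s))
        + Complex.log ((n : ℂ) + 1) * (1 / ((n : ℂ) + 1) ^ s)
        + (u - 1) * (1 / ((n : ℂ) + 1) ^ (s + 1)
          - s * (Complex.log ((n : ℂ) + 1) * (1 / ((n : ℂ) + 1) ^ (s + 1))))) s := by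
  have key (c : ℂ) (hc : c ≠ 0) (z : ℂ) :
      HasDerivAt (fun s : ℂ => 1 / c ^ s) (-(Complex.log c * (1 / c ^ z))) z := by
    simp only [one_div, ← Complex.cpow_neg]
    convert (hasDerivAt_neg z).const_cpow (c := c) (Or.inl hc) using 1
    ring
  have h1 : (n : ℂ) + u ≠ 0 := by
    exact_mod_cast (by positivity : (n : ℝ) + u ≠ 0)
  have h2 : (n : ℂ) + 1 ≠ 0 := by exact_mod_cast n.succ_ne_zero
  have h3 := (key _ h2 (s + 1)).comp_add_const s 1
  refine (((key _ h1 s).fun_sub (key _ h2 s)).fun_add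
    (((hasDerivAt_id' s).fun_mul h3).const_mul ((u : ℂ) - 1))).congr_deriv ?_
  ring

theorem hasSum_lerchTerm_of_one_lt_re {u : ℝ} (hu : 0 < u) (hu1 : u ≤ 1) {s : ℂ}
    (hs : 1 < s.re) :
    HasSum (fun n => lerchTerm u n s)
      (HurwitzZeta.hurwitzZeta (u : UnitAddCircle) s - riemannZeta s
        + (u - 1) * riemannZeta₁ (s + 1)) := by
  have h (z : ℂ) (hz : 1 < z.re) :
      HasSum (fun n : ℕ => 1 / ((n : ℂ) + 1) ^ z) (riemannZeta z) := by
    have := HurwitzZeta.hasSum_hurwitzZeta_of_one_lt_re (a := 1) (by simp) hz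
    simpa [AddCircle.coe_period, HurwitzZeta.hurwitzZeta_zero] using this
  have hs1 : 1 < (s + 1).re := by simp; linarith
  have hne : s + 1 ≠ 1 := by
    rintro h
    have : s = 0 := by simpa using h
    simp [this] at hs
    linarith
  have hs0 : s ≠ 0 := by simpa using hne
  have e : riemannZeta₁ (s + 1) = s * riemannZeta (s + 1) := by
    rw [riemannZeta_eq_inv_sub_mul hne, add_sub_cancel_right, mul_inv_cancel_left₀ hs0]
  rw [e]
  exact ((HurwitzZeta.hasSum_hurwitzZeta_of_one_lt_re ⟨hu.le, hu1⟩ hs).sub (h s hs)).add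
    (((h _ hs1).mul_left s).mul_left _)

/-- Both sides are holomorphic on the connected `lerchDomain` and agree near 2, where the Dirichlet
series converge. -/
theorem tsum_lerchTerm {u : ℝ} (hu : 0 < u) (hu1 : u ≤ 1) {s : ℂ} (hs : s ∈ lerchDomain) :
    ∑' n, lerchTerm u n s = HurwitzZeta.hurwitzZeta (u : UnitAddCircle) s
      - HurwitzZeta.hurwitzZeta 0 s + (u - 1) * riemannZeta₁ (s + 1) := by
  have hd : DifferentiableOn ℂ (fun s => ∑' n, lerchTerm u n s) lerchDomain :=
    Complex.differentiableOn_tsum_of_summable_norm (summable_lerchBound u)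
      (fun n s _ => (hasDerivAt_lerchTerm hu n s).differentiableAt.differentiableWithinAt)
      isOpen_lerchDomain fun n s hs => norm_lerchTerm_le hu hu1 n hs
  have hd' : Differentiable ℂ (fun s => HurwitzZeta.hurwitzZeta (u : UnitAddCircle) s
      - HurwitzZeta.hurwitzZeta 0 s + (u - 1) * riemannZeta₁ (s + 1)) :=
    (HurwitzZeta.differentiable_hurwitzZeta_sub_hurwitzZeta _ _).add (by fun_prop)
  refine (hd.analyticOnNhd isOpen_lerchDomain).eqOn_of_preconnected_of_eventuallyEq
    (hd'.differentiableOn.analyticOnNhd isOpen_lerchDomain) convex_lerchDomain.isPreconnected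
    (z₀ := 2) ⟨by simp; norm_num, by simp; norm_num⟩ ?_ hs
  have : ∀ᶠ s : ℂ in 𝓝 2, 1 < s.re :=
    (isOpen_lt continuous_const Complex.continuous_re).mem_nhds (by simp)
  filter_upwards [this] with s hs
  rw [(hasSum_lerchTerm_of_one_lt_re hu hu1 hs).tsum_eq, HurwitzZeta.hurwitzZeta_zero]

theorem zero_mem_lerchDomain : (0 : ℂ) ∈ lerchDomain := ⟨by simp, by simp⟩

/-- Every `lerchTerm` vanishes at `s = 0`. -/
theorem hurwitzZeta_apply_zero {u : ℝ} (hu : 0 < u) (hu1 : u ≤ 1) :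
    HurwitzZeta.hurwitzZeta (u : UnitAddCircle) 0 = 1 / 2 - u := by
  have h := tsum_lerchTerm hu hu1 zero_mem_lerchDomain
  simp [lerchTerm, HurwitzZeta.hurwitzZeta_zero, riemannZeta_zero] at h
  linear_combination -h

/-- The partial sums are those of Gauss' limit for `log Γ(u)`, plus `(u - 1) (H_{n+1} - log (n +
1))`, plus `u (log (n + 1) - log n)`, which tends to 0. -/
theorem hasSum_log_Gamma {u : ℝ} (hu : 0 < u) {a : ℝ}
    (h : HasSum (fun n : ℕ => -Real.log (n + u) + Real.log (n + 1) + (u - 1) * (1 / (n + 1))) a) :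
    a = Real.log (Real.Gamma u) + (u - 1) * Real.eulerMascheroniConstant := by
  have h1 := (tendsto_add_atTop_iff_nat 1).mpr h.tendsto_sum_nat
  have h2 := Real.BohrMollerup.tendsto_log_gamma hu
  have h3 : Tendsto (fun n : ℕ => (harmonic (n + 1) : ℝ) - Real.log ((n + 1 : ℕ) : ℝ)) atTop
      (𝓝 Real.eulerMascheroniConstant) :=
    (tendsto_add_atTop_iff_nat 1).mpr Real.tendsto_harmonic_sub_log
  have h4 : Tendsto (fun n : ℕ => Real.log ((n : ℝ) + 1) - Real.log n) atTop (𝓝 0) :=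
    Real.tendsto_log_nat_add_one_sub_log
  have h5 := (h2.add (h3.const_mul (u - 1))).add (h4.const_mul u)
  rw [mul_zero, add_zero] at h5
  refine tendsto_nhds_unique h1 (h5.congr fun n => ?_)
  simp only [Real.BohrMollerup.logGammaSeq, Finset.sum_add_distrib, ← Finset.mul_sum, harmonic]
  have h6 : ∑ i ∈ Finset.range (n + 1), Real.log ((i : ℝ) + 1)
      = Real.log (n.factorial : ℝ) + Real.log ((n : ℝ) + 1) := by
    rw [Finset.sum_range_succ]
    congr 1
    rw [← Finset.prod_range_add_one_eq_factorial, Nat.cast_prod, Real.log_prod]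
    · simp
    · intro i _; positivity
  rw [h6]
  push_cast
  simp only [Finset.sum_neg_distrib, one_div, add_comm u]
  ring

/-- Differentiate the series termwise at 0. The `γ` from the derivative of `s ζ(s + 1)` cancels the
one in `hasSum_log_Gamma`. -/
theorem deriv_hurwitzZeta_zero {u : ℝ} (hu : 0 < u) (hu1 : u ≤ 1) :
    deriv (HurwitzZeta.hurwitzZeta (u : UnitAddCircle)) 0 =
      Real.log (Real.Gamma u) + deriv riemannZeta 0 := by
  have hs := Complex.hasSum_deriv_of_summable_norm (summable_lerchBound u)
    (fun n s _ => (hasDerivAt_lerchTerm hu n s).differentiableAt.differentiableWithinAt)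
    isOpen_lerchDomain (fun n s hs => norm_lerchTerm_le hu hu1 n hs) zero_mem_lerchDomain
  have hz (a : UnitAddCircle) : DifferentiableAt ℂ (HurwitzZeta.hurwitzZeta a) 0 :=
    HurwitzZeta.differentiableAt_hurwitzZeta a zero_ne_one
  have he : deriv (fun s => ∑' n, lerchTerm u n s) 0 =
      deriv (HurwitzZeta.hurwitzZeta (u : UnitAddCircle)) 0 - deriv riemannZeta 0
        + (u - 1) * Real.eulerMascheroniConstant := by
    have hev : (fun s => ∑' n, lerchTerm u n s) =ᶠ[𝓝 0]
        fun s => HurwitzZeta.hurwitzZeta (u : UnitAddCircle) s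
          - HurwitzZeta.hurwitzZeta 0 s + (u - 1) * riemannZeta₁ (s + 1) := by
      filter_upwards [isOpen_lerchDomain.mem_nhds zero_mem_lerchDomain] with s hs
      exact tsum_lerchTerm hu hu1 hs
    rw [hev.deriv_eq, deriv_fun_add ((hz _).fun_sub (hz _)) (by fun_prop),
      deriv_fun_sub (hz _) (hz _), deriv_const_mul_field, deriv_comp_add_const,
      HurwitzZeta.hurwitzZeta_zero]
    simp
  rw [he] at hs
  simp only [(hasDerivAt_lerchTerm hu _ _).deriv] at hs
  have hr (n : ℕ) : -(Complex.log ((n : ℂ) + u) * (1 / ((n : ℂ) + u) ^ (0 : ℂ)))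
        + Complex.log ((n : ℂ) + 1) * (1 / ((n : ℂ) + 1) ^ (0 : ℂ))
        + (u - 1) * (1 / ((n : ℂ) + 1) ^ ((0 : ℂ) + 1)
          - 0 * (Complex.log ((n : ℂ) + 1) * (1 / ((n : ℂ) + 1) ^ ((0 : ℂ) + 1)))) =
      ((-Real.log (n + u) + Real.log (n + 1) + (u - 1) * (1 / (n + 1)) : ℝ) : ℂ) := by
    push_cast [Complex.ofReal_log (by positivity : (0 : ℝ) ≤ n + u),
      Complex.ofReal_log (by positivity : (0 : ℝ) ≤ (n : ℝ) + 1)]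
    simp
  simp only [hr] at hs
  have hre := Complex.hasSum_re hs
  simp only [Complex.ofReal_re] at hre
  have := (Complex.hasSum_ofReal.mpr hre).unique hs
  rw [hasSum_log_Gamma hu hre] at this
  push_cast at this
  linear_combination -this

/-! ### The sine zeta function at rationals, and finite sine sums -/

theorem ZMod.sum_univ_eq_sum_Icc {q : ℕ} [NeZero q] (g : ZMod q → ℂ) :
    ∑ k : ZMod q, g k = ∑ j ∈ Finset.Icc 1 q, g (j : ZMod q) := by
  have h1 : ∑ k : ZMod q, g k = ∑ j ∈ Finset.range q, g (j : ZMod q) :=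
    Finset.sum_nbij' ZMod.val (fun j => (j : ZMod q)) (by simp [ZMod.val_lt]) (by simp)
      (by simp) (fun j hj => ZMod.val_cast_of_lt (Finset.mem_range.mp hj)) (by simp)
  have h2 := Finset.sum_range_succ (fun j : ℕ => g (j : ZMod q)) q
  rw [Finset.sum_range_succ'] at h2
  have h3 : ∑ j ∈ Finset.Icc 1 q, g (j : ZMod q) = ∑ j ∈ Finset.range q, g ((j + 1 : ℕ) : ZMod q) :=
    Finset.sum_nbij' (fun j => j - 1) (fun j => j + 1)
      (fun j hj => by simp only [Finset.mem_Icc, Finset.mem_range] at *; lia)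
      (fun j hj => by simp only [Finset.mem_Icc, Finset.mem_range] at *; lia)
      (fun j hj => by simp only [Finset.mem_Icc] at hj; lia) (fun j _ => by lia)
      (fun j hj => by rw [Nat.sub_add_cancel (Finset.mem_Icc.mp hj).1])
  rw [Nat.cast_zero, ZMod.natCast_self] at h2
  rw [h1, h3, add_right_cancel h2]

/-- The exponential zeta function at `±p/q` is the L-function of an additive character mod `q`,
hence a finite combination of Hurwitz zeta functions; subtracting the two signs leaves sines. -/
theorem sinZeta_eq_sum {p q : ℕ} (hp : 0 < p) (hpq : p < q) (s : ℂ) :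
    HurwitzZeta.sinZeta (((p : ℝ) / (q : ℝ) : ℝ) : UnitAddCircle) s =
      (q : ℂ) ^ (-s) * ∑ j ∈ Finset.Icc 1 q,
        (Real.sin (2 * Real.pi * (j : ℝ) * (p : ℝ) / (q : ℝ)) : ℂ)
          * HurwitzZeta.hurwitzZeta (((j : ℝ) / (q : ℝ) : ℝ) : UnitAddCircle) s := by
  have : NeZero q := ⟨by lia⟩
  have hp0 : (p : ZMod q) ≠ 0 := by
    rw [Ne, ZMod.natCast_eq_zero_iff]
    exact fun h => absurd (Nat.le_of_dvd hp h) (by lia)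
  have h1 := ZMod.LFunction_stdAddChar_eq_expZeta (p : ZMod q) s (Or.inl hp0)
  have h2 := ZMod.LFunction_stdAddChar_eq_expZeta (-(p : ZMod q)) s (Or.inl (neg_ne_zero.mpr hp0))
  rw [map_neg, ZMod.toAddCircle_natCast] at h2
  rw [ZMod.toAddCircle_natCast] at h1
  rw [HurwitzZeta.sinZeta_eq, ← h1, ← h2, ZMod.LFunction, ZMod.LFunction,
    ZMod.sum_univ_eq_sum_Icc, ZMod.sum_univ_eq_sum_Icc, ← mul_sub, mul_div_assoc,
    ← Finset.sum_sub_distrib, Finset.sum_div]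
  congr 1
  refine Finset.sum_congr rfl fun j _ => ?_
  have e1 := ZMod.stdAddChar_coe (N := q) ((p * j : ℕ) : ℤ)
  have e2 := ZMod.stdAddChar_coe (N := q) (-((p * j : ℕ) : ℤ))
  push_cast at e1 e2
  rw [neg_mul, e1, e2, ZMod.toAddCircle_natCast, Complex.ofReal_sin, Complex.sin, ← sub_mul]
  push_cast
  rw [show -(2 * (Real.pi : ℂ) * j * p / q) * Complex.I
      = 2 * Real.pi * Complex.I * -(p * j) / q by ring,
    show (2 * (Real.pi : ℂ) * j * p / q) * Complex.I
      = 2 * Real.pi * Complex.I * (p * j) / q by ring]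
  field_simp
  rw [Complex.I_sq]
  ring

theorem two_mul_sin_mul_sum_sin (x : ℝ) (n : ℕ) :
    2 * Real.sin x * ∑ j ∈ Finset.Icc 1 n, Real.sin (2 * j * x)
      = Real.cos x - Real.cos (2 * n * x + x) := by
  induction n with
  | zero => simp
  | succ n ih =>
    rw [Finset.sum_Icc_succ_top (by lia), mul_add, ih]
    have h1 : 2 * (n : ℝ) * x + x = 2 * (n + 1 : ℕ) * x - x := by push_cast; ring
    rw [h1, Real.cos_sub, Real.cos_add]
    ring

/-- Summation by parts applied to the telescoping `2 sin x sin 2jx = cos (2j-1)x - cos (2j+1)x`,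
here verified by induction. -/
theorem four_mul_sin_sq_mul_sum_mul_sin (x : ℝ) (n : ℕ) :
    4 * Real.sin x ^ 2 * ∑ j ∈ Finset.Icc 1 n, (j : ℝ) * Real.sin (2 * j * x)
      = Real.sin (2 * n * x) - 2 * n * Real.sin x * Real.cos (2 * n * x + x) := by
  induction n with
  | zero => simp
  | succ n ih =>
    rw [Finset.sum_Icc_succ_top (by lia), mul_add, ih]
    have h1 : 2 * (n : ℝ) * x + x = 2 * (n + 1 : ℕ) * x - x := by push_cast; ring
    have h2 : 2 * (n : ℝ) * x = 2 * (n + 1 : ℕ) * x - x - x := by push_cast; ring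
    rw [h1, h2]
    set y := 2 * ((n + 1 : ℕ) : ℝ) * x
    have h3 := Real.sin_sq_add_cos_sq x
    simp only [Real.sin_sub, Real.cos_sub, Real.cos_add]
    push_cast
    linear_combination Real.sin y * h3

theorem sin_pi_mul_div_ne_zero {p q : ℕ} (hp : 0 < p) (hpq : p < q) :
    Real.sin (Real.pi * p / q) ≠ 0 := by
  have hq : (0 : ℝ) < q := by exact_mod_cast hp.trans hpq
  have hp' : (0 : ℝ) < p := by exact_mod_cast hp
  have hpq' : (p : ℝ) < q := by exact_mod_cast hpq
  refine (Real.sin_pos_of_pos_of_lt_pi (by positivity) ?_).ne'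
  rw [div_lt_iff₀ hq]
  exact mul_lt_mul_of_pos_left hpq' Real.pi_pos

theorem sum_sin_two_pi_div {p q : ℕ} (hp : 0 < p) (hpq : p < q) :
    ∑ j ∈ Finset.Icc 1 q, Real.sin (2 * Real.pi * (j : ℝ) * (p : ℝ) / (q : ℝ)) = 0 := by
  have hq : (q : ℝ) ≠ 0 := by exact_mod_cast (hp.trans hpq).ne'
  have h := two_mul_sin_mul_sum_sin (Real.pi * p / q) q
  rw [show 2 * (q : ℝ) * (Real.pi * p / q) + Real.pi * p / q
    = Real.pi * p / q + p * (2 * Real.pi) by field_simp; ring, Real.cos_add_nat_mul_two_pi,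
    sub_self] at h
  rw [← (mul_eq_zero.mp h).resolve_left (mul_ne_zero two_ne_zero (sin_pi_mul_div_ne_zero hp hpq))]
  exact Finset.sum_congr rfl fun j _ => by ring_nf

theorem sum_mul_sin_two_pi_div {p q : ℕ} (hp : 0 < p) (hpq : p < q) :
    ∑ j ∈ Finset.Icc 1 q, Real.sin (2 * Real.pi * (j : ℝ) * (p : ℝ) / (q : ℝ)) * (j / q)
      = -Real.cot (Real.pi * p / q) / 2 := by
  have hq : (q : ℝ) ≠ 0 := by exact_mod_cast (hp.trans hpq).ne'
  have hs := sin_pi_mul_div_ne_zero hp hpq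
  have h := four_mul_sin_sq_mul_sum_mul_sin (Real.pi * p / q) q
  rw [show 2 * (q : ℝ) * (Real.pi * p / q) + Real.pi * p / q
    = Real.pi * p / q + p * (2 * Real.pi) by field_simp; ring, Real.cos_add_nat_mul_two_pi,
    show 2 * (q : ℝ) * (Real.pi * p / q) = 0 + p * (2 * Real.pi) by field_simp; ring,
    Real.sin_add_nat_mul_two_pi, Real.sin_zero] at h
  have e : ∑ j ∈ Finset.Icc 1 q, Real.sin (2 * Real.pi * (j : ℝ) * (p : ℝ) / (q : ℝ)) * (j / q)
      = (∑ j ∈ Finset.Icc 1 q, (j : ℝ) * Real.sin (2 * j * (Real.pi * p / q))) / q := by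
    rw [Finset.sum_div]
    exact Finset.sum_congr rfl fun j _ => by ring_nf
  rw [e, Real.cot_eq_cos_div_sin]
  generalize ∑ j ∈ Finset.Icc 1 q, (j : ℝ) * Real.sin (2 * j * (Real.pi * p / q)) = T at *
  generalize Real.sin (Real.pi * p / q) = S at *
  have h' : 2 * S * T = -(q * Real.cos (Real.pi * p / q)) := by
    apply mul_left_cancel₀ (mul_ne_zero two_ne_zero hs)
    linear_combination h
  field_simp
  linear_combination h'

/-! ### Taylor data of the sine combination at 0 -/

/-- The combination of Hurwitz zeta functions occurring in `sinZeta (p / q)`. -/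
noncomputable def sinHurwitzSum (p q : ℕ) (s : ℂ) : ℂ :=
  ∑ j ∈ Finset.Icc 1 q, (Real.sin (2 * Real.pi * (j : ℝ) * (p : ℝ) / (q : ℝ)) : ℂ)
    * HurwitzZeta.hurwitzZeta (((j : ℝ) / (q : ℝ) : ℝ) : UnitAddCircle) s

theorem analyticAt_hurwitzZeta (a : UnitAddCircle) {s : ℂ} (hs : s ≠ 1) :
    AnalyticAt ℂ (HurwitzZeta.hurwitzZeta a) s := by
  rw [Complex.analyticAt_iff_eventually_differentiableAt]
  filter_upwards [isOpen_ne.mem_nhds hs] with z hz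
  exact HurwitzZeta.differentiableAt_hurwitzZeta a hz

theorem analyticAt_sinHurwitzSum (p q : ℕ) : AnalyticAt ℂ (sinHurwitzSum p q) 0 :=
  Finset.analyticAt_fun_sum _ fun _ _ =>
    analyticAt_const.mul (analyticAt_hurwitzZeta _ zero_ne_one)

theorem iteratedDeriv_sinHurwitzSum_zero (p q n : ℕ) :
    iteratedDeriv n (sinHurwitzSum p q) 0 =
      ∑ j ∈ Finset.Icc 1 q, (Real.sin (2 * Real.pi * (j : ℝ) * (p : ℝ) / (q : ℝ)) : ℂ)
        * iteratedDeriv n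
          (HurwitzZeta.hurwitzZeta (((j : ℝ) / (q : ℝ) : ℝ) : UnitAddCircle)) 0 := by
  unfold sinHurwitzSum
  rw [iteratedDeriv_fun_sum fun j _ =>
    (analyticAt_const.fun_mul (analyticAt_hurwitzZeta _ zero_ne_one)).contDiffAt]
  exact Finset.sum_congr rfl fun j _ => iteratedDeriv_const_mul_field _ _

theorem natCast_div_mem_Ioc {j q : ℕ} (hj : j ∈ Finset.Icc 1 q) :
    0 < (j : ℝ) / q ∧ (j : ℝ) / q ≤ 1 := by
  obtain ⟨h1, h2⟩ := Finset.mem_Icc.mp hj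
  have h1' : (0 : ℝ) < j := by exact_mod_cast h1
  have h2' : (j : ℝ) ≤ q := by exact_mod_cast h2
  exact ⟨div_pos h1' (h1'.trans_le h2'), div_le_one_of_le₀ h2' (by positivity)⟩

theorem sinHurwitzSum_zero {p q : ℕ} (hp : 0 < p) (hpq : p < q) :
    sinHurwitzSum p q 0 = ((Real.cot (Real.pi * p / q) / 2 : ℝ) : ℂ) := by
  have h : sinHurwitzSum p q 0 =
      ((1 / 2 * ∑ j ∈ Finset.Icc 1 q, Real.sin (2 * Real.pi * (j : ℝ) * (p : ℝ) / (q : ℝ))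
        - ∑ j ∈ Finset.Icc 1 q,
          Real.sin (2 * Real.pi * (j : ℝ) * (p : ℝ) / (q : ℝ)) * (j / q) : ℝ) : ℂ) := by
    rw [Finset.mul_sum, ← Finset.sum_sub_distrib, Complex.ofReal_sum]
    refine Finset.sum_congr rfl fun j hj => ?_
    rw [hurwitzZeta_apply_zero (natCast_div_mem_Ioc hj).1 (natCast_div_mem_Ioc hj).2]
    push_cast
    ring
  rw [h, sum_sin_two_pi_div hp hpq, sum_mul_sin_two_pi_div hp hpq]
  congr 1
  ring

theorem deriv_sinHurwitzSum_zero {p q : ℕ} (hp : 0 < p) (hpq : p < q) :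
    deriv (sinHurwitzSum p q) 0 = ((∑ j ∈ Finset.Icc 1 q,
      Real.sin (2 * Real.pi * (j : ℝ) * (p : ℝ) / (q : ℝ))
        * Real.log (Real.Gamma ((j : ℝ) / (q : ℝ))) : ℝ) : ℂ) := by
  have h := iteratedDeriv_sinHurwitzSum_zero p q 1
  simp only [iteratedDeriv_one] at h
  have h0 : ∑ j ∈ Finset.Icc 1 q,
      (Real.sin (2 * Real.pi * (j : ℝ) * (p : ℝ) / (q : ℝ)) : ℂ) = 0 := by
    exact_mod_cast sum_sin_two_pi_div hp hpq
  have h1 : deriv (sinHurwitzSum p q) 0 = ∑ j ∈ Finset.Icc 1 q,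
      (((Real.sin (2 * Real.pi * (j : ℝ) * (p : ℝ) / (q : ℝ))
        * Real.log (Real.Gamma ((j : ℝ) / (q : ℝ))) : ℝ) : ℂ)
        + (Real.sin (2 * Real.pi * (j : ℝ) * (p : ℝ) / (q : ℝ)) : ℂ) * deriv riemannZeta 0) := by
    rw [h]
    refine Finset.sum_congr rfl fun j hj => ?_
    rw [deriv_hurwitzZeta_zero (natCast_div_mem_Ioc hj).1 (natCast_div_mem_Ioc hj).2,
      Complex.ofReal_mul, mul_add]
  rw [h1, Finset.sum_add_distrib, ← Finset.sum_mul, h0, zero_mul, add_zero, Complex.ofReal_sum]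

/-! ### The functional equation and its second derivative -/

theorem hurwitzZeta_sub_neg_one_sub_eventuallyEq {p q : ℕ} (hp : 0 < p) (hpq : p < q) :
    (fun s : ℂ =>
      HurwitzZeta.hurwitzZeta (((p : ℝ) / (q : ℝ) : ℝ) : UnitAddCircle) (1 - s)
        - HurwitzZeta.hurwitzZeta (-(((p : ℝ) / (q : ℝ) : ℝ) : UnitAddCircle)) (1 - s)) =ᶠ[𝓝 0]
      fun s => oddFactor (Real.log (2 * Real.pi * (q : ℝ))) s * sinHurwitzSum p q s := by
  have hq : (0 : ℝ) < q := by exact_mod_cast hp.trans hpq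
  have hD := HurwitzZeta.differentiable_hurwitzZeta_sub_hurwitzZeta
    (((p : ℝ) / (q : ℝ) : ℝ) : UnitAddCircle) (-(((p : ℝ) / (q : ℝ) : ℝ) : UnitAddCircle))
  have hL : ContinuousAt (fun s : ℂ =>
      HurwitzZeta.hurwitzZeta (((p : ℝ) / (q : ℝ) : ℝ) : UnitAddCircle) (1 - s)
        - HurwitzZeta.hurwitzZeta (-(((p : ℝ) / (q : ℝ) : ℝ) : UnitAddCircle)) (1 - s)) 0 :=
    (hD.continuous.comp (continuous_const.sub continuous_id)).continuousAt
  -- The functional equation excludes `s = 0`, a pole of `Γ(s)`. In the form `Γ(1 + s) ·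
  -- sin(πs/2)/s` the right side is continuous there, so the punctured neighbourhood suffices.
  rw [← hL.eventuallyEq_nhds_iff_eventuallyEq_nhdsNE
    ((analyticAt_oddFactor _).fun_mul (analyticAt_sinHurwitzSum p q)).continuousAt]
  have h1 : ∀ᶠ s : ℂ in 𝓝[≠] 0, -1 < s.re :=
    nhdsWithin_le_nhds <|
      (isOpen_lt continuous_const Complex.continuous_re).mem_nhds (by simp)
  filter_upwards [h1, self_mem_nhdsWithin] with s hs hs0
  replace hs0 : s ≠ 0 := hs0
  have hsn (n : ℕ) : s ≠ -n := by
    rintro rfl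
    simp at hs
    have : n = 0 := by lia
    exact hs0 (by simp [this])
  have h2 := HurwitzZeta.hurwitzZetaOdd_eq (((p : ℝ) / (q : ℝ) : ℝ) : UnitAddCircle) (1 - s)
  rw [HurwitzZeta.hurwitzZetaOdd_one_sub _ hsn, sinZeta_eq_sum hp hpq] at h2
  have h3 : Complex.exp (-(Real.log (2 * Real.pi * (q : ℝ)) : ℂ) * s)
      = (2 * Real.pi : ℂ) ^ (-s) * (q : ℂ) ^ (-s) := by
    have e := Complex.mul_cpow_ofReal_nonneg (by positivity : 0 ≤ 2 * Real.pi) hq.le (-s)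
    push_cast at e
    have hne : (2 * Real.pi * q : ℂ) ≠ 0 := by
      exact_mod_cast (by positivity : 2 * Real.pi * (q : ℝ) ≠ 0)
    rw [← e, Complex.cpow_def_of_ne_zero hne, Complex.ofReal_log (by positivity)]
    push_cast
    ring_nf
  have h4 : Complex.Gamma (1 + s) = s * Complex.Gamma s := by
    rw [add_comm, Complex.Gamma_add_one s hs0]
  have h5 := mul_sinDiv (Real.pi / 2) s
  rw [show (Real.pi : ℂ) / 2 * s = Real.pi * s / 2 by ring] at h5
  rw [oddFactor, h3, h4, sinHurwitzSum]
  rw [← h5] at h2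
  linear_combination -2 * h2

theorem iteratedDeriv_two_hurwitzZeta_sub_neg_one {p q : ℕ} (hp : 0 < p) (hpq : p < q) :
    iteratedDeriv 2 (fun s : ℂ =>
      HurwitzZeta.hurwitzZeta (((p : ℝ) / (q : ℝ) : ℝ) : UnitAddCircle) s
        - HurwitzZeta.hurwitzZeta (-(((p : ℝ) / (q : ℝ) : ℝ) : UnitAddCircle)) s) 1 =
      2 * (Real.pi : ℂ) * ∑ j ∈ Finset.Icc 1 q,
            (Real.sin (2 * Real.pi * (j : ℝ) * (p : ℝ) / (q : ℝ)) : ℂ)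
              * iteratedDeriv 2
                  (HurwitzZeta.hurwitzZeta (((j : ℝ) / (q : ℝ) : ℝ) : UnitAddCircle)) 0
          - ((4 * Real.pi * (Real.eulerMascheroniConstant + Real.log (2 * Real.pi * (q : ℝ)))
              * ∑ j ∈ Finset.Icc 1 q,
                  Real.sin (2 * Real.pi * (j : ℝ) * (p : ℝ) / (q : ℝ))
                    * Real.log (Real.Gamma ((j : ℝ) / (q : ℝ))) : ℝ) : ℂ)
          + ((Real.pi / 2
              * (2 * (Real.eulerMascheroniConstant + Real.log (2 * Real.pi * (q : ℝ))) ^ 2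
                  + Real.pi ^ 2 / 6)
              * Real.cot (Real.pi * (p : ℝ) / (q : ℝ)) : ℝ) : ℂ) := by
  have h := (hurwitzZeta_sub_neg_one_sub_eventuallyEq hp hpq).iteratedDeriv_eq 2
  rw [iteratedDeriv_comp_const_sub 2 (fun s : ℂ =>
      HurwitzZeta.hurwitzZeta (((p : ℝ) / (q : ℝ) : ℝ) : UnitAddCircle) s
        - HurwitzZeta.hurwitzZeta (-(((p : ℝ) / (q : ℝ) : ℝ) : UnitAddCircle)) s) 1,
    iteratedDeriv_two_fun_mul (analyticAt_oddFactor _) (analyticAt_sinHurwitzSum p q),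
    oddFactor_zero, deriv_oddFactor_zero, iteratedDeriv_two_oddFactor_zero,
    sinHurwitzSum_zero hp hpq, deriv_sinHurwitzSum_zero hp hpq,
    iteratedDeriv_sinHurwitzSum_zero] at h
  simp only [sub_zero, even_two.neg_one_pow, one_smul] at h
  rw [h]
  simp only [Complex.ofReal_mul, Complex.ofReal_add, Complex.ofReal_div, Complex.ofReal_pow,
    Complex.ofReal_ofNat]
  ring

/-! ### Passage to the limit and to the Stieltjes constants -/

/-- The principal parts cancel off 1, and continuity of both sides extends the equality to 1. -/
theorem hurwitzRegularPart_sub (u v : ℝ) :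
    (fun s => hurwitzRegularPart u s - hurwitzRegularPart v s) = fun s =>
      HurwitzZeta.hurwitzZeta (u : UnitAddCircle) s
        - HurwitzZeta.hurwitzZeta (v : UnitAddCircle) s := by
  have h1 := ((differentiable_hurwitzRegularPart u).sub
    (differentiable_hurwitzRegularPart v)).continuous
  have h2 := (HurwitzZeta.differentiable_hurwitzZeta_sub_hurwitzZeta
    (u : UnitAddCircle) (v : UnitAddCircle)).continuous
  refine Continuous.ext_on (dense_compl_singleton (1 : ℂ)) h1 h2 fun s hs => ?_
  have hs' : s ≠ 1 := hs
  simp [hurwitzRegularPart, hs']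
theorem mainTheorem5 (p q : ℕ) (hp : 0 < p) (hpq : p < q) :
    Tendsto
      (fun s : ℂ =>
        iteratedDeriv 2 (HurwitzZeta.hurwitzZeta (((p : ℝ) / (q : ℝ) : ℝ) : UnitAddCircle)) s
          - iteratedDeriv 2
              (HurwitzZeta.hurwitzZeta ((1 - (p : ℝ) / (q : ℝ) : ℝ) : UnitAddCircle)) s)
      (𝓝[≠] 1)
      (𝓝 (2 * (Real.pi : ℂ) * ∑ j ∈ Finset.Icc 1 q,
            (Real.sin (2 * Real.pi * (j : ℝ) * (p : ℝ) / (q : ℝ)) : ℂ)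
              * iteratedDeriv 2
                  (HurwitzZeta.hurwitzZeta (((j : ℝ) / (q : ℝ) : ℝ) : UnitAddCircle)) 0
          - ((4 * Real.pi * (Real.eulerMascheroniConstant + Real.log (2 * Real.pi * (q : ℝ)))
              * ∑ j ∈ Finset.Icc 1 q,
                  Real.sin (2 * Real.pi * (j : ℝ) * (p : ℝ) / (q : ℝ))
                    * Real.log (Real.Gamma ((j : ℝ) / (q : ℝ))) : ℝ) : ℂ)
          + ((Real.pi / 2
              * (2 * (Real.eulerMascheroniConstant + Real.log (2 * Real.pi * (q : ℝ))) ^ 2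
                  + Real.pi ^ 2 / 6)
              * Real.cot (Real.pi * (p : ℝ) / (q : ℝ)) : ℝ) : ℂ)))
    ∧ stieltjesConst 2 ((p : ℝ) / (q : ℝ)) - stieltjesConst 2 (1 - (p : ℝ) / (q : ℝ))
      = 2 * (Real.pi : ℂ) * ∑ j ∈ Finset.Icc 1 q,
            (Real.sin (2 * Real.pi * (j : ℝ) * (p : ℝ) / (q : ℝ)) : ℂ)
              * iteratedDeriv 2
                  (HurwitzZeta.hurwitzZeta (((j : ℝ) / (q : ℝ) : ℝ) : UnitAddCircle)) 0
          - ((4 * Real.pi * (Real.eulerMascheroniConstant + Real.log (2 * Real.pi * (q : ℝ)))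
              * ∑ j ∈ Finset.Icc 1 q,
                  Real.sin (2 * Real.pi * (j : ℝ) * (p : ℝ) / (q : ℝ))
                    * Real.log (Real.Gamma ((j : ℝ) / (q : ℝ))) : ℝ) : ℂ)
          + ((Real.pi / 2
              * (2 * (Real.eulerMascheroniConstant + Real.log (2 * Real.pi * (q : ℝ))) ^ 2
                  + Real.pi ^ 2 / 6)
              * Real.cot (Real.pi * (p : ℝ) / (q : ℝ)) : ℝ) : ℂ) := by
  have hneg : ((1 - (p : ℝ) / (q : ℝ) : ℝ) : UnitAddCircle)
      = -(((p : ℝ) / (q : ℝ) : ℝ) : UnitAddCircle) := by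
    rw [AddCircle.coe_sub, AddCircle.coe_period, zero_sub]
  have hR := iteratedDeriv_two_hurwitzZeta_sub_neg_one hp hpq
  constructor
  · rw [← hR, hneg]
    have hD := HurwitzZeta.differentiable_hurwitzZeta_sub_hurwitzZeta
      (((p : ℝ) / (q : ℝ) : ℝ) : UnitAddCircle) (-(((p : ℝ) / (q : ℝ) : ℝ) : UnitAddCircle))
    have hc := (hD.contDiff (n := 2)).continuous_iteratedDeriv 2 le_rfl
    -- Only the difference is regular at 1, so its derivative is split into two just for `s ≠ 1`.
    refine ((hc.tendsto 1).mono_left nhdsWithin_le_nhds).congr' ?_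
    filter_upwards [self_mem_nhdsWithin] with s hs
    exact iteratedDeriv_fun_sub (analyticAt_hurwitzZeta _ hs).contDiffAt
      (analyticAt_hurwitzZeta _ hs).contDiffAt
  · rw [← hR, ← hneg, ← hurwitzRegularPart_sub, iteratedDeriv_fun_sub
      ((differentiable_hurwitzRegularPart _).analyticAt _).contDiffAt
      ((differentiable_hurwitzRegularPart _).analyticAt _).contDiffAt]
    simp [stieltjesConst]
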